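/- Let $\mathbb{k}$ be a field. For a monomial ideal $I$ in a polynomial ring $S$ over $\mathbb{k}$ in finitely many variables (each of degree $1$), let $\beta_{i,j}(I)=\dim_{\mathbb{k}}\operatorname{Tor}^S_i(I,\mathbb{k})_j$ and $\beta_i(I)=\sum_{j}\beta_{i,j}(I)$, where $\mathbb{k}$ is the quotient of $S$ by the ideal generated by all the variables, and put $\beta_i(I)=0$ for $i<0$. The ideal $I$ is said to have a $d$-linear resolution if it is generated in degree $d$ and $\beta_{i,i+j}(I)=0$ for all $i\ge 0$ and all $j\neq d$. Let $I\subseteq S=\mathbb{k}[x_1,\dots,x_n]$ be a squarefree monomial ideal with a $d$-linear resolution. Let $k$ be a positive integer, let $y_1,\dots,y_k$ be new variables and let $\mathfrak{n}=(y_1,\dots,y_k)$. Then the ideal $\mathfrak{n}I$ of $R=\mathbb{k}[x_1,\dots,x_n,y_1,\dots,y_k]$ (the product of the ideals of $R$ generated by $\mathfrak{n}$ and by $I$) has a $(d+1)$-linear resolution, and $$\beta_i(\mathfrak{n}I)=\sum_{s=0}^{k-1}\binom{k}{s+1}\,\beta_{i-s}(I)\qquad\text{for every } i\ge 0,$$ where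 the Betti numbers of $I$ are taken over $S$ and those of $\mathfrak{n}I$ over $R$. -/

import Mathlib

namespace LinRes

open MvPolynomial

set_option linter.unusedSectionVars false

variable {𝕜 : Type*} [Field 𝕜] {σ : Type*} [Fintype σ] [LinearOrder σ]

/-- The sign with which the basis vector `e_T` occurs in the contraction of `e_{T ∪ {v}}`
along `v`: it is `(-1)` to the number of elements of `T` that precede `v`. -/
def koszulSign (𝕜 : Type*) [Field 𝕜] {σ : Type*} [LinearOrder σ] (v : σ) (T : Finset σ) : 𝕜 :=
  (-1) ^ (T.filter (fun u => u < v)).card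

/-- The differential of the Koszul complex of all the variables of `S = 𝕜[x_v : v ∈ σ]`.  The family
`c` stands for the chain `∑_T c_T e_T` in `⨁_T S e_T`, where `T` runs over the finite subsets of the
set of variables, and `∂ e_U = ∑_{v ∈ U} ± x_v e_{U ∖ {v}}`. -/
noncomputable def koszulDiff (𝕜 : Type*) [Field 𝕜] (σ : Type*) [Fintype σ] [LinearOrder σ] :
    (Finset σ → MvPolynomial σ 𝕜) →ₗ[𝕜] (Finset σ → MvPolynomial σ 𝕜) where
  toFun c T := ∑ v ∈ Tᶜ, koszulSign 𝕜 v T • (X v * c (insert v T))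
  map_add' a b := by
    funext T
    simp [mul_add, Finset.sum_add_distrib]
  map_smul' r a := by
    funext T
    simp only [Pi.smul_apply, RingHom.id_apply, Finset.smul_sum, mul_smul_comm]
    exact Finset.sum_congr rfl fun v _ => smul_comm _ _ _

/-- The degree `j` part of the `i`-th term `I ⊗ P_i = ⨁_{|T| = i} I e_T` of the complex `I ⊗ P`,
where `P` is the Koszul complex and `e_T` has degree `|T|`: all coefficients
lie in `I`, and every monomial `m e_T` that occurs has `|T| = i` and total degree
`deg m + |T| = j`. -/
noncomputable def koszulPiece (I : Ideal (MvPolynomial σ 𝕜)) (i j : ℕ) :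
    Submodule 𝕜 (Finset σ → MvPolynomial σ 𝕜) where
  carrier := {c | ∀ T, c T ∈ I ∧ ∀ m, coeff m (c T) ≠ 0 → T.card = i ∧ m.degree + T.card = j}
  add_mem' {a b} ha hb T := by
    refine ⟨I.add_mem (ha T).1 (hb T).1, fun m hm => ?_⟩
    by_cases h : coeff m (a T) = 0
    · refine (hb T).2 m fun h' => hm ?_
      simp [h, h']
    · exact (ha T).2 m h
  zero_mem' T := by simp
  smul_mem' r a ha T := by
    refine ⟨?_, fun m hm => (ha T).2 m fun h => hm (by simp [h])⟩
    rw [Pi.smul_apply, MvPolynomial.smul_eq_C_mul]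
    exact I.mul_mem_left _ (ha T).1

/-- The degree `j` part of the `i`-cycles of `I ⊗ P`. -/
noncomputable def torCycles (I : Ideal (MvPolynomial σ 𝕜)) (i j : ℕ) :
    Submodule 𝕜 (Finset σ → MvPolynomial σ 𝕜) :=
  koszulPiece I i j ⊓ LinearMap.ker (koszulDiff 𝕜 σ)

/-- The degree `j` part of the `i`-boundaries of `I ⊗ P`. -/
noncomputable def torBoundaries (I : Ideal (MvPolynomial σ 𝕜)) (i j : ℕ) :
    Submodule 𝕜 (Finset σ → MvPolynomial σ 𝕜) :=
  (koszulPiece I (i + 1) j).map (koszulDiff 𝕜 σ)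

/-- The graded `𝕜`-vector space `Tor_i^S(I, 𝕜)_j` for a homogeneous ideal `I` of
`S = 𝕜[x_v : v ∈ σ]` and `𝕜 = S / (x_v : v ∈ σ)`: the degree `j` part of `H_i(I ⊗_S P)`, where
`P` is the graded free resolution of `𝕜` given by the Koszul complex of the variables
(`torBoundaries_le_torCycles` and `torCycles_top_le` below check that `P` is a complex and that
it resolves `𝕜`). -/
abbrev GradedTor (I : Ideal (MvPolynomial σ 𝕜)) (i j : ℕ) : Type _ :=
  torCycles I i j ⧸ (torBoundaries I i j).submoduleOf (torCycles I i j)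

/-- The graded Betti number `β_{i,j}(I) = dim_𝕜 Tor_i(I, 𝕜)_j`. -/
noncomputable def gradedBetti (I : Ideal (MvPolynomial σ 𝕜)) (i j : ℕ) : ℕ :=
  Module.finrank 𝕜 (GradedTor I i j)

/-- The total Betti number `β_i(I) = ∑_j β_{i,j}(I)`. -/
noncomputable def totalBetti (I : Ideal (MvPolynomial σ 𝕜)) (i : ℕ) : ℕ :=
  ∑ᶠ j : ℕ, gradedBetti I i j

/-- `I` is generated by its elements that are homogeneous of degree `d`. -/
def IsGeneratedInDegree (I : Ideal (MvPolynomial σ 𝕜)) (d : ℕ) : Prop :=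
  I = Ideal.span {f | f ∈ I ∧ f.IsHomogeneous d}

/-- `I` has a `d`-linear resolution: it is generated in degree `d`, and `β_{i,a}(I)` vanishes
unless `a = i + d`. -/
def HasLinearResolution (I : Ideal (MvPolynomial σ 𝕜)) (d : ℕ) : Prop :=
  IsGeneratedInDegree I d ∧ ∀ i a : ℕ, a ≠ i + d → gradedBetti I i a = 0

/-- `I` is generated by squarefree monomials. -/
def IsSquarefreeMonomialIdeal (I : Ideal (MvPolynomial σ 𝕜)) : Prop :=
  ∃ A : Set (σ →₀ ℕ), (∀ a ∈ A, ∀ v, a v ≤ 1) ∧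
    I = Ideal.span ((fun a => monomial a (1 : 𝕜)) '' A)

theorem koszulDiff_apply (c : Finset σ → MvPolynomial σ 𝕜) (T : Finset σ) :
    koszulDiff 𝕜 σ c T = ∑ v ∈ Tᶜ, koszulSign 𝕜 v T • (X v * c (insert v T)) := rfl

theorem koszulSign_swap (u v : σ) (T : Finset σ) (huv : u ≠ v) (hu : u ∉ T) (hv : v ∉ T) :
    koszulSign 𝕜 v T * koszulSign 𝕜 u (insert v T) =
      -(koszulSign 𝕜 u T * koszulSign 𝕜 v (insert u T)) := by
  unfold koszulSign
  rw [Finset.filter_insert, Finset.filter_insert]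
  rcases lt_or_gt_of_ne huv with h | h
  · rw [if_neg (not_lt.mpr h.le), if_pos h, Finset.card_insert_of_notMem (by simp [hu])]
    ring
  · rw [if_pos h, if_neg (not_lt.mpr h.le), Finset.card_insert_of_notMem (by simp [hv])]
    ring

theorem koszulDiff_koszulDiff (c : Finset σ → MvPolynomial σ 𝕜) :
    koszulDiff 𝕜 σ (koszulDiff 𝕜 σ c) = 0 := by
  funext T
  simp only [koszulDiff_apply, Finset.mul_sum, Finset.smul_sum, Pi.zero_apply]
  rw [Finset.sum_sigma']
  refine Finset.sum_involution (fun p _ => ⟨p.2, p.1⟩) ?_ ?_ ?_ ?_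
  · rintro ⟨v, u⟩ h
    simp only [Finset.mem_sigma, Finset.mem_compl, Finset.mem_insert, not_or] at h
    obtain ⟨hv, huv, hu⟩ := h
    simp only [mul_smul_comm, smul_smul]
    rw [koszulSign_swap u v T huv hu hv, Finset.insert_comm u v T, mul_left_comm (X v), neg_smul,
      neg_add_cancel]
  · rintro ⟨v, u⟩ h _ he
    simp only [Finset.mem_sigma, Finset.mem_compl, Finset.mem_insert, not_or] at h
    simp only [Sigma.mk.injEq] at he
    exact h.2.1 he.1
  · rintro ⟨v, u⟩ h
    simp only [Finset.mem_sigma, Finset.mem_compl, Finset.mem_insert, not_or] at h ⊢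
    exact ⟨h.2.2, fun e => h.2.1 e.symm, h.1⟩
  · rintro ⟨v, u⟩ _
    rfl

theorem coeff_koszulDiff (c : Finset σ → MvPolynomial σ 𝕜) (T : Finset σ) (m : σ →₀ ℕ) :
    coeff m (koszulDiff 𝕜 σ c T) = ∑ v ∈ Tᶜ, koszulSign 𝕜 v T *
      (if m v = 0 then 0 else coeff (m - Finsupp.single v 1) (c (insert v T))) := by
  rw [koszulDiff_apply, MvPolynomial.coeff_sum]
  refine Finset.sum_congr rfl fun v _ => ?_
  rw [MvPolynomial.coeff_smul, MvPolynomial.coeff_X_mul', smul_eq_mul]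
  by_cases h : m v = 0 <;> simp [h]

theorem degree_sub_single (m : σ →₀ ℕ) (v : σ) (h : m v ≠ 0) :
    (m - Finsupp.single v 1).degree + 1 = m.degree := by
  have h1 : m - Finsupp.single v 1 + Finsupp.single v 1 = m :=
    tsub_add_cancel_of_le (by simpa [Finsupp.single_le_iff] using Nat.one_le_iff_ne_zero.mpr h)
  conv_rhs => rw [← h1]
  simp

/-- `P` is a complex, and its differential preserves degrees and the multiples of `I`. -/
theorem torBoundaries_le_torCycles (I : Ideal (MvPolynomial σ 𝕜)) (i j : ℕ) :
    torBoundaries I i j ≤ torCycles I i j := by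
  rintro _ ⟨b, hb, rfl⟩
  refine ⟨fun T => ⟨?_, fun m hm => ?_⟩, koszulDiff_koszulDiff b⟩
  · rw [koszulDiff_apply]
    refine I.sum_mem fun v _ => ?_
    rw [MvPolynomial.smul_eq_C_mul]
    exact I.mul_mem_left _ (I.mul_mem_left _ (hb _).1)
  · rw [coeff_koszulDiff] at hm
    obtain ⟨v, hv, hne⟩ := Finset.exists_ne_zero_of_sum_ne_zero hm
    have hmv : m v ≠ 0 := fun h => hne (by simp [h])
    rw [if_neg hmv] at hne
    have h2 := (hb (insert v T)).2 _ (right_ne_zero_of_mul hne)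
    rw [Finset.card_insert_of_notMem (by simpa using hv)] at h2
    have h3 := degree_sub_single m v hmv
    omega

/-- Contracting homotopy for the Koszul complex: it moves the least variable
that occurs in a monomial `m e_T` from `m` to `e_T`. -/
noncomputable def koszulHomotopy (c : Finset σ → MvPolynomial σ 𝕜) (U : Finset σ) :
    MvPolynomial σ 𝕜 :=
  if h : U.Nonempty then
    ∑ m ∈ ((c (U.erase (U.min' h))).support.image (fun m => m - Finsupp.single (U.min' h) 1)),
      monomial m (if ∀ u < U.min' h, m u = 0 then
        coeff (m + Finsupp.single (U.min' h) 1) (c (U.erase (U.min' h))) else 0)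
  else 0

theorem coeff_koszulHomotopy (c : Finset σ → MvPolynomial σ 𝕜) (U : Finset σ) (h : U.Nonempty)
    (m : σ →₀ ℕ) : coeff m (koszulHomotopy c U) =
      if ∀ u < U.min' h, m u = 0 then
        coeff (m + Finsupp.single (U.min' h) 1) (c (U.erase (U.min' h))) else 0 := by
  rw [koszulHomotopy, dif_pos h, MvPolynomial.coeff_sum]
  simp only [MvPolynomial.coeff_monomial]
  rw [Finset.sum_ite_eq']
  split_ifs with h1 h2
  · rfl
  · rfl
  · by_contra hne
    refine h1 (Finset.mem_image.mpr ⟨m + Finsupp.single (U.min' h) 1, ?_, ?_⟩)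
    · exact MvPolynomial.mem_support_iff.mpr (Ne.symm hne)
    · simp
  · rfl

/-- If `w` is the least variable of `m e_U`, and it lies in `U`. -/
theorem coeff_koszulHomotopy_of_mem (c : Finset σ → MvPolynomial σ 𝕜) (U : Finset σ)
    (m : σ →₀ ℕ) (w : σ) (hw : w ∈ U) (hU : ∀ u ∈ U, w ≤ u) (hm : ∀ u < w, m u = 0) :
    coeff m (koszulHomotopy c U) = coeff (m + Finsupp.single w 1) (c (U.erase w)) := by
  have h : U.Nonempty := ⟨w, hw⟩
  have e : U.min' h = w := le_antisymm (U.min'_le w hw) (hU _ (U.min'_mem h))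
  rw [coeff_koszulHomotopy c U h, e, if_pos hm]

/-- If a variable `w` of `m` precedes all of `U`. -/
theorem coeff_koszulHomotopy_of_lt (c : Finset σ → MvPolynomial σ 𝕜) (U : Finset σ)
    (m : σ →₀ ℕ) (w : σ) (hU : ∀ u ∈ U, w < u) (hm : m w ≠ 0) :
    coeff m (koszulHomotopy c U) = 0 := by
  by_cases h : U.Nonempty
  · rw [coeff_koszulHomotopy c U h, if_neg]
    exact fun h' => hm (h' w (hU _ (U.min'_mem h)))
  · rw [koszulHomotopy, dif_neg h, coeff_zero]

theorem koszulSign_eq_one (v : σ) (T : Finset σ) (h : ∀ u ∈ T, v ≤ u) :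
    koszulSign 𝕜 v T = 1 := by
  rw [koszulSign, Finset.filter_false_of_mem (fun u hu => not_lt.mpr (h u hu))]
  simp

theorem koszulDiff_koszulHomotopy (c : Finset σ → MvPolynomial σ 𝕜)
    (hc : koszulDiff 𝕜 σ c = 0) (h0 : coeff 0 (c ∅) = 0) :
    koszulDiff 𝕜 σ (koszulHomotopy c) = c := by
  funext T
  ext m
  rw [coeff_koszulDiff]
  by_cases hA : (m.support ∪ T).Nonempty
  swap
  · rw [Finset.not_nonempty_iff_eq_empty, Finset.union_eq_empty, Finsupp.support_eq_empty] at hA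
    obtain ⟨rfl, rfl⟩ := hA
    simp [h0]
  obtain ⟨w, hwA, hmin⟩ : ∃ w ∈ m.support ∪ T, ∀ u ∈ m.support ∪ T, w ≤ u :=
    ⟨_, Finset.min'_mem _ hA, fun u hu => Finset.min'_le _ u hu⟩
  have hminm : ∀ u < w, m u = 0 := fun u hu => by
    by_contra h
    exact absurd (hmin u (by simp [h])) (not_le.mpr hu)
  have hminT : ∀ u ∈ T, w ≤ u := fun u hu => hmin u (by simp [hu])
  by_cases hwT : w ∈ T
  · set T' := T.erase w with hT'
    have hTT' : insert w T' = T := Finset.insert_erase hwT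
    have hwT' : w ∉ T' := Finset.notMem_erase w T
    have hlt : ∀ u ∈ T', w < u := fun u hu =>
      lt_of_le_of_ne (hminT u (Finset.mem_of_mem_erase hu)) (Finset.ne_of_mem_erase hu).symm
    have key := coeff_koszulDiff c T' (m + Finsupp.single w 1)
    rw [hc, Pi.zero_apply, coeff_zero] at key
    have hcompl : T'ᶜ = insert w Tᶜ := by
      ext u
      simp only [hT', Finset.mem_compl, Finset.mem_erase, Finset.mem_insert]
      tauto
    rw [hcompl, Finset.sum_insert (by simp [hwT]), koszulSign_eq_one w T' (fun u hu => (hlt u hu).le),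
      hTT'] at key
    simp only [Finsupp.add_apply, Finsupp.single_eq_same, Nat.add_eq_zero_iff, one_ne_zero, and_false,
      if_false, add_tsub_cancel_right, one_mul] at key
    rw [eq_comm, add_eq_zero_iff_eq_neg, ← Finset.sum_neg_distrib] at key
    rw [key]
    refine Finset.sum_congr rfl fun v hv => ?_
    have hvT : v ∉ T := by simpa using hv
    have hvw : v ≠ w := fun e => hvT (e ▸ hwT)
    by_cases hmv : m v = 0
    · simp [hmv, hvw]
    have hwv : w < v := lt_of_le_of_ne (hmin v (by simp [hmv])) hvw.symm
    have hsign : koszulSign 𝕜 v T = -koszulSign 𝕜 v T' := by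
      rw [← hTT', koszulSign, koszulSign, Finset.filter_insert, if_pos hwv,
        Finset.card_insert_of_notMem (by simp [hwT'])]
      ring
    have hmem : ∀ u ∈ insert v T, w ≤ u := fun u hu => by
      rcases Finset.mem_insert.mp hu with rfl | hu
      · exact hwv.le
      · exact hminT u hu
    rw [if_neg hmv, if_neg (by simp [hmv]), hsign, coeff_koszulHomotopy_of_mem c (insert v T) _ w
      (Finset.mem_insert_of_mem hwT) hmem (fun u hu => by simp [hminm u hu]),
      Finset.erase_insert_of_ne hvw, ← hT', neg_mul]
    congr 4
    ext u
    by_cases hu : u = v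
    · subst hu
      simp [Finsupp.single_eq_of_ne hvw]
    · simp [Finsupp.single_eq_of_ne hu]
  · have hmw : m w ≠ 0 := by
      rcases Finset.mem_union.mp hwA with h | h
      · exact Finsupp.mem_support_iff.mp h
      · exact absurd h hwT
    have hlt : ∀ u ∈ T, w < u := fun u hu =>
      lt_of_le_of_ne (hminT u hu) (fun e => hwT (e ▸ hu))
    rw [Finset.sum_eq_single w]
    · rw [if_neg hmw, koszulSign_eq_one w T hminT, one_mul, coeff_koszulHomotopy_of_mem c _ _ w
        (Finset.mem_insert_self w T) (fun u hu => ?_) (fun u hu => by simp [hminm u hu]),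
        Finset.erase_insert hwT, tsub_add_cancel_of_le]
      · simpa [Finsupp.single_le_iff] using Nat.one_le_iff_ne_zero.mpr hmw
      · rcases Finset.mem_insert.mp hu with rfl | hu
        · exact le_rfl
        · exact hminT u hu
    · intro v hv hvw
      by_cases hmv : m v = 0
      · simp [hmv]
      have hwv : w < v := lt_of_le_of_ne (hmin v (by simp [hmv])) hvw.symm
      rw [if_neg hmv, coeff_koszulHomotopy_of_lt c _ _ w (fun u hu => ?_), mul_zero]
      · simp [Finsupp.single_eq_of_ne hvw.symm, hmw]
      · rcases Finset.mem_insert.mp hu with rfl | hu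
        · exact hwv
        · exact hlt u hu
    · intro h
      exact absurd (Finset.mem_compl.mpr hwT) h

/-- `P` resolves `𝕜`: its homology is concentrated in homological degree `0` and internal
degree `0`, where the homology is `𝕜 e_∅`. -/
theorem torCycles_top_le (i j : ℕ) (hij : (i, j) ≠ (0, 0)) :
    torCycles (⊤ : Ideal (MvPolynomial σ 𝕜)) i j ≤ torBoundaries ⊤ i j := by
  rintro c ⟨hc, hker⟩
  refine ⟨koszulHomotopy c, fun U => ⟨trivial, fun m hm => ?_⟩,
    koszulDiff_koszulHomotopy c hker ?_⟩
  · by_cases h : U.Nonempty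
    · rw [coeff_koszulHomotopy c U h] at hm
      split_ifs at hm with h1
      · have h2 := (hc _).2 _ hm
        rw [Finset.card_erase_of_mem (U.min'_mem h)] at h2
        have h3 := h.card_pos
        simp only [map_add, Finsupp.degree_single] at h2
        omega
      · exact absurd rfl hm
    · rw [koszulHomotopy, dif_neg h, coeff_zero] at hm
      exact absurd rfl hm
  · by_contra hne
    have h2 := (hc ∅).2 0 hne
    simp only [Finset.card_empty, map_zero] at h2
    exact hij (by rw [← h2.1, ← h2.2])

end LinRes

namespace LinRes

open MvPolynomial

set_option linter.unusedSectionVars false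

/-! ### Contracting the Koszul complex from the greatest variable -/

section Contraction

variable {𝕜 : Type*} [Field 𝕜] {σ : Type*} [Fintype σ] [LinearOrder σ]

/-! Let `IR` be the extension of `I` to `R`. Setting the variables y to zero maps `IR` onto `I`, and
the kernel is the product 𝔫I. This gives an exact sequence 0 → 𝔫I → `IR` → I → 0 of `R`-modules in
which the y act on I by zero. Therefore Tor^R(I, 𝕜) is the direct sum, over all sets W of variables
y, of copies Tor^S(I, 𝕜) e_W with both degrees shifted by |W|, while Tor^R(`IR`, 𝕜) = Tor^S(I, 𝕜)
maps isomorphically onto the copy W = ∅. What remains is Tor_i(𝔫I)_j ≅ ⨁_{W ≠ ∅}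
Tor_{i+1-|W|}(I)_{j-|W|}. If I has a d-linear resolution, every summand forces j = i + d + 1. The k
choose s+1 sets W of size s+1 each contribute β_{i-s}(I), which is the formula.

On Koszul chains the isomorphism is induced by `connecting`, (z_W) ↦ ∂(∑ z_W e_W). Its surjectivity
and its kernel (`connecting_surjective`, `ker_connecting`) both rest on
`exists_koszulDiff_eq_of_slice_empty`: a cycle over `IR` in which every monomial m e_T involves some
y bounds a chain of the same kind. Indeed the generators of `IR` are free of y, so a contraction
that only moves variables y from m to e_T never leaves the ideal. -/

theorem exists_koszulDiff_eq_of_min (c : Finset σ → MvPolynomial σ 𝕜)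
    (hc : koszulDiff 𝕜 σ c = 0) (h0 : coeff 0 (c ∅) = 0) :
    ∃ g, koszulDiff 𝕜 σ g = c ∧ ∀ U m, coeff m (g U) ≠ 0 →
      ∃ w ∈ U, (∀ u ∈ U, w ≤ u) ∧ (∀ u < w, m u = 0) ∧
        coeff (m + Finsupp.single w 1) (c (U.erase w)) ≠ 0 := by
  refine ⟨koszulHomotopy c, koszulDiff_koszulHomotopy c hc h0, fun U m hm => ?_⟩
  by_cases h : U.Nonempty
  · rw [coeff_koszulHomotopy c U h] at hm
    split_ifs at hm with h1
    · exact ⟨_, U.min'_mem h, fun u hu => U.min'_le u hu, h1, hm⟩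
    · exact absurd rfl hm
  · rw [koszulHomotopy, dif_neg h, coeff_zero] at hm
    exact absurd rfl hm

/-- As v is not in T, the elements of T before v and those after v together number |T|. -/
theorem koszulSign_reverse {σ : Type*} (L : LinearOrder σ) [LinearOrder σ]
    (hL : ∀ u v, L.lt u v ↔ v < u) (v : σ)
    (T : Finset σ) (hv : v ∉ T) :
    @koszulSign 𝕜 _ σ L v T = (-1) ^ T.card * koszulSign 𝕜 v T := by
  have h : T.card = (T.filter fun u => u < v).card + (T.filter fun u => v < u).card := by
    rw [← Finset.card_filter_add_card_filter_not (s := T) (fun u => u < v)]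
    congr 2
    refine Finset.filter_congr fun u hu => ?_
    have : u ≠ v := fun e => hv (e ▸ hu)
    rw [not_lt, le_iff_lt_or_eq]
    simp [this.symm]
  have h2 : @koszulSign 𝕜 _ σ L v T = (-1) ^ (T.filter fun u => v < u).card := by
    unfold koszulSign
    congr 2
    ext u
    simp only [Finset.mem_filter]
    exact and_congr_right fun _ => hL u v
  have h3 : koszulSign 𝕜 v T = (-1) ^ (T.filter fun u => u < v).card := rfl
  rw [h2, h, h3, pow_add, mul_right_comm, ← pow_add, Even.neg_one_pow ⟨_, rfl⟩, one_mul]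

theorem koszulDiff_reverse {σ : Type*} [Fintype σ] (L : LinearOrder σ) [LinearOrder σ]
    (hL : ∀ u v, L.lt u v ↔ v < u)
    (c : Finset σ → MvPolynomial σ 𝕜) (T : Finset σ) :
    @koszulDiff 𝕜 _ σ _ L c T = ((-1) ^ T.card : 𝕜) • koszulDiff 𝕜 σ c T := by
  rw [@koszulDiff_apply 𝕜 _ σ _ L, koszulDiff_apply, Finset.smul_sum]
  refine Finset.sum_congr ?_ fun v hv => ?_
  · ext u
    simp only [Finset.mem_compl]
  · rw [smul_smul, ← koszulSign_reverse L hL v T (by simpa using hv)]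
    -- The two orders carry different decidable equalities, so the two sets `insert v T` are matched
    -- by extensionality.
    congr 3
    ext u
    simp only [Finset.mem_insert]

theorem exists_koszulDiff_eq_of_reverse {σ : Type*} [Fintype σ] (L : LinearOrder σ)
    [LinearOrder σ] (hL : ∀ u v, L.lt u v ↔ v < u) (hL' : ∀ u v, L.le u v ↔ v ≤ u) (c : Finset σ → MvPolynomial σ 𝕜)
    (hc : koszulDiff 𝕜 σ c = 0) (h0 : coeff 0 (c ∅) = 0) :
    ∃ g, koszulDiff 𝕜 σ g = c ∧ ∀ U m, coeff m (g U) ≠ 0 →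
      ∃ w ∈ U, (∀ u ∈ U, u ≤ w) ∧ (∀ u, w < u → m u = 0) ∧
        coeff (m + Finsupp.single w 1) (c (U.erase w)) ≠ 0 := by
  obtain ⟨g, hg, hsupp⟩ := @exists_koszulDiff_eq_of_min 𝕜 _ σ _ L c (by
    funext T
    rw [koszulDiff_reverse L hL, hc]
    simp) h0
  -- For U = T ∪ {v} the exponent is |T| + 2, so this factor reproduces the sign (-1)^|T| of the
  -- reversed differential.
  refine ⟨fun U => ((-1) ^ (U.card + 1) : 𝕜) • g U, ?_, fun U m hm => ?_⟩
  · funext T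
    rw [← hg, koszulDiff_reverse L hL, koszulDiff_apply, koszulDiff_apply, Finset.smul_sum]
    refine Finset.sum_congr rfl fun v hv => ?_
    rw [Finset.card_insert_of_notMem (by simpa using hv), mul_smul_comm, smul_comm]
    congr 1
    ring
  · rw [coeff_smul] at hm
    obtain ⟨w, hw, h1, h2, h3⟩ := hsupp U m (right_ne_zero_of_mul hm)
    refine ⟨w, hw, fun u hu => (hL' _ _).1 (h1 u hu), fun u hu => h2 u ((hL _ _).2 hu), ?_⟩
    convert h3 using 3
    ext u
    simp only [Finset.mem_erase]

/-- The contraction of the Koszul complex that uses the greatest variable of each monomial. -/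
theorem exists_koszulDiff_eq_of_max (c : Finset σ → MvPolynomial σ 𝕜)
    (hc : koszulDiff 𝕜 σ c = 0) (h0 : coeff 0 (c ∅) = 0) :
    ∃ g, koszulDiff 𝕜 σ g = c ∧ ∀ U m, coeff m (g U) ≠ 0 →
      ∃ w ∈ U, (∀ u ∈ U, u ≤ w) ∧ (∀ u, w < u → m u = 0) ∧
        coeff (m + Finsupp.single w 1) (c (U.erase w)) ≠ 0 :=
  exists_koszulDiff_eq_of_reverse (inferInstanceAs (LinearOrder σᵒᵈ)) (fun _ _ => Iff.rfl)
    (fun _ _ => Iff.rfl) c hc h0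

end Contraction

/-! ### Adjoining the variables y; the product ideal as a kernel -/

section Variables

variable {𝕜 : Type*} [Field 𝕜] {α β : Type*}

theorem inl_injective : Function.Injective (fun a : α => (toLex (Sum.inl a) : α ⊕ₗ β)) :=
  fun _ _ h => Sum.inl_injective (toLex.injective h)

theorem inr_injective : Function.Injective (fun b : β => (toLex (Sum.inr b) : α ⊕ₗ β)) :=
  fun _ _ h => Sum.inr_injective (toLex.injective h)

theorem inl_ne_inr (a : α) (b : β) : (toLex (Sum.inl a) : α ⊕ₗ β) ≠ toLex (Sum.inr b) :=
  fun h => Sum.inl_ne_inr (toLex.injective h)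

/-- The inclusion `𝕜[x] → 𝕜[x, y]`. -/
noncomputable def incl (𝕜 : Type*) [Field 𝕜] (α β : Type*) :
    MvPolynomial α 𝕜 →ₐ[𝕜] MvPolynomial (α ⊕ₗ β) 𝕜 :=
  rename fun a : α => toLex (Sum.inl a)

/-- The retraction `𝕜[x, y] → 𝕜[x]` that sends the variables `y` to `0`. -/
noncomputable def retr (𝕜 : Type*) [Field 𝕜] (α β : Type*) :
    MvPolynomial (α ⊕ₗ β) 𝕜 →ₐ[𝕜] MvPolynomial α 𝕜 :=
  killCompl inl_injective

/-- The ideal of `𝕜[x, y]` generated by the variables `y`. -/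
noncomputable def yIdeal (𝕜 : Type*) [Field 𝕜] (α β : Type*) :
    Ideal (MvPolynomial (α ⊕ₗ β) 𝕜) :=
  Ideal.span (Set.range fun b : β => X (toLex (Sum.inr b)))

@[simp] theorem retr_incl (f : MvPolynomial α 𝕜) : retr 𝕜 α β (incl 𝕜 α β f) = f :=
  killCompl_rename_app _ f

@[simp] theorem retr_X_inl (a : α) :
    retr 𝕜 α β (X (toLex (Sum.inl a))) = X a := by
  rw [← retr_incl (β := β) (X a : MvPolynomial α 𝕜), incl, rename_X]

@[simp] theorem retr_X_inr (b : β) : retr 𝕜 α β (X (toLex (Sum.inr b))) = 0 := by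
  rw [retr, killCompl, aeval_X, dif_neg]
  rintro ⟨a, ha⟩
  exact inl_ne_inr a b ha

theorem sub_incl_retr_mem (f : MvPolynomial (α ⊕ₗ β) 𝕜) :
    f - incl 𝕜 α β (retr 𝕜 α β f) ∈ yIdeal 𝕜 α β := by
  rw [← Ideal.Quotient.eq]
  have h : Ideal.Quotient.mkₐ 𝕜 (yIdeal 𝕜 α β) =
      (Ideal.Quotient.mkₐ 𝕜 (yIdeal 𝕜 α β)).comp ((incl 𝕜 α β).comp (retr 𝕜 α β)) := by
    refine MvPolynomial.algHom_ext fun v => ?_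
    obtain ⟨v, rfl⟩ := toLex.surjective v
    rcases v with a | b
    · simp [incl]
    · simp only [AlgHom.comp_apply, retr_X_inr, map_zero, Ideal.Quotient.mkₐ_eq_mk]
      exact Ideal.Quotient.eq_zero_iff_mem.mpr (Ideal.subset_span ⟨b, rfl⟩)
  exact AlgHom.congr_fun h f

theorem yIdeal_le_ker : yIdeal 𝕜 α β ≤ RingHom.ker (retr 𝕜 α β) := by
  rw [yIdeal, Ideal.span_le]
  rintro _ ⟨b, rfl⟩
  exact retr_X_inr b

variable (I : Ideal (MvPolynomial α 𝕜))

theorem incl_mem {f : MvPolynomial α 𝕜} (hf : f ∈ I) : incl 𝕜 α β f ∈ I.map (incl 𝕜 α β) :=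
  Ideal.mem_map_of_mem _ hf

theorem retr_mem {f : MvPolynomial (α ⊕ₗ β) 𝕜} (hf : f ∈ I.map (incl 𝕜 α β)) :
    retr 𝕜 α β f ∈ I := by
  have h : I.map (incl 𝕜 α β) ≤ I.comap (retr 𝕜 α β) := by
    rw [Ideal.map_le_iff_le_comap]
    intro g hg
    simpa using hg
  exact h hf

/-- Exactness of 0 → 𝔫I → `IR` → I → 0. An element of `IR` differs from its y-free part by an
element of the product: this is clear on generators, which are y-free, and passes to multiples
because r and its y-free part agree modulo the y. -/
theorem mem_yIdeal_mul_iff (f : MvPolynomial (α ⊕ₗ β) 𝕜) :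
    f ∈ yIdeal 𝕜 α β * I.map (incl 𝕜 α β) ↔ f ∈ I.map (incl 𝕜 α β) ∧ retr 𝕜 α β f = 0 := by
  refine ⟨fun h => ⟨?_, ?_⟩, ?_⟩
  · exact Ideal.mul_le_right h
  · have h' : f ∈ yIdeal 𝕜 α β := Ideal.mul_le_left h
    exact RingHom.mem_ker.mp (yIdeal_le_ker h')
  have key : ∀ g ∈ I.map (incl 𝕜 α β),
      g - incl 𝕜 α β (retr 𝕜 α β g) ∈ yIdeal 𝕜 α β * I.map (incl 𝕜 α β) := by
    intro g hg
    induction hg using Submodule.span_induction with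
    | mem g hg =>
      obtain ⟨g, hg, rfl⟩ := hg
      simp
    | zero => simp
    | add g h _ _ hg hh =>
      have : g + h - incl 𝕜 α β (retr 𝕜 α β (g + h)) =
        (g - incl 𝕜 α β (retr 𝕜 α β g)) + (h - incl 𝕜 α β (retr 𝕜 α β h)) := by
        simp only [map_add]
        ring
      rw [this]
      exact add_mem hg hh
    | smul r g hmem hg =>
      have : r • g - incl 𝕜 α β (retr 𝕜 α β (r • g)) =
        (r - incl 𝕜 α β (retr 𝕜 α β r)) * g +
          incl 𝕜 α β (retr 𝕜 α β r) * (g - incl 𝕜 α β (retr 𝕜 α β g)) := by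
        simp only [smul_eq_mul, map_mul]
        ring
      rw [this]
      exact add_mem (Ideal.mul_mem_mul (sub_incl_retr_mem r) hmem) (Ideal.mul_mem_left _ _ hg)
  rintro ⟨h1, h2⟩
  simpa [h2] using key f h1

theorem coeff_retr (f : MvPolynomial (α ⊕ₗ β) 𝕜) (m : α →₀ ℕ) :
    coeff m (retr 𝕜 α β f) = coeff (m.mapDomain fun a => toLex (Sum.inl a)) f := by
  classical
  induction f using MvPolynomial.induction_on' with
  | add p q hp hq => rw [map_add, coeff_add, coeff_add, hp, hq]
  | monomial u r =>
    by_cases hu : (u.support : Set (α ⊕ₗ β)) ⊆ Set.range fun a : α => toLex (Sum.inl a)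
    · obtain ⟨u', rfl⟩ : ∃ u' : α →₀ ℕ, u = u'.mapDomain fun a => toLex (Sum.inl a) :=
        ⟨u.comapDomain _ inl_injective.injOn, (Finsupp.mapDomain_comapDomain _ inl_injective u hu).symm⟩
      rw [retr, killCompl_monomial_mapDomain, coeff_monomial, coeff_monomial]
      simp only [(Finsupp.mapDomain_injective inl_injective).eq_iff]
    · rw [retr, killCompl_monomial_eq_zero_of_not_subset _ _ hu, coeff_zero, coeff_monomial,
        if_neg]
      rintro rfl
      refine hu fun v hv => ?_
      have := Finsupp.mapDomain_support hv
      simp only [Finset.mem_image] at this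
      obtain ⟨a, -, rfl⟩ := this
      exact ⟨a, rfl⟩

/-- The exponents in the image of `A` vanish on the y, so cancelling a factor y_b preserves
divisibility by a generator. -/
theorem add_single_inr_mem {A : Set (α →₀ ℕ)} (b : β) (m : (α ⊕ₗ β) →₀ ℕ)
    (h : ∃ s ∈ (Finsupp.mapDomain fun a => (toLex (Sum.inl a) : α ⊕ₗ β)) '' A,
      s ≤ m + Finsupp.single (toLex (Sum.inr b)) 1) :
    ∃ s ∈ (Finsupp.mapDomain fun a => (toLex (Sum.inl a) : α ⊕ₗ β)) '' A, s ≤ m := by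
  classical
  obtain ⟨_, ⟨s, hs, rfl⟩, hle⟩ := h
  refine ⟨_, ⟨s, hs, rfl⟩, fun v => ?_⟩
  obtain ⟨v, rfl⟩ := toLex.surjective v
  rcases v with a | b'
  · simpa [Finsupp.single_apply, (inl_ne_inr a b).symm] using hle (toLex (Sum.inl a))
  · rw [Finsupp.mapDomain_of_notMem_range]
    · exact Nat.zero_le _
    · rintro ⟨a, ha⟩
      exact inl_ne_inr a b' ha

theorem mem_map_incl_span_monomial_iff (A : Set (α →₀ ℕ)) (f : MvPolynomial (α ⊕ₗ β) 𝕜) :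
    f ∈ (Ideal.span ((fun a => monomial a (1 : 𝕜)) '' A)).map (incl 𝕜 α β) ↔
      ∀ m, coeff m f ≠ 0 →
        ∃ s ∈ (Finsupp.mapDomain fun a => (toLex (Sum.inl a) : α ⊕ₗ β)) '' A, s ≤ m := by
  have h : (Ideal.span ((fun a => monomial a (1 : 𝕜)) '' A)).map (incl 𝕜 α β) =
      Ideal.span ((fun a => monomial a (1 : 𝕜)) ''
        ((Finsupp.mapDomain fun a => (toLex (Sum.inl a) : α ⊕ₗ β)) '' A)) := by
    rw [Ideal.map_span, Set.image_image, Set.image_image]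
    congr 1
    refine Set.image_congr fun a _ => ?_
    exact rename_monomial _ _ _
  rw [h, mem_ideal_span_monomial_image]
  simp only [mem_support_iff]

end Variables

/-! ### Splitting a set of variables into its x-part and y-part -/

section Faces

variable {α β : Type*} [Fintype α] [LinearOrder α] [Fintype β] [LinearOrder β]

/-- The set of variables of `𝕜[x, y]` with `x`-part `A` and `y`-part `W`. -/
def glue (A : Finset α) (W : Finset β) : Finset (α ⊕ₗ β) :=
  A.map ⟨_, inl_injective⟩ ∪ W.map ⟨_, inr_injective⟩

/-- The `x`-part of a set of variables of `𝕜[x, y]`. -/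
def xPart (T : Finset (α ⊕ₗ β)) : Finset α :=
  Finset.univ.filter fun a => toLex (Sum.inl a) ∈ T

/-- The `y`-part of a set of variables of `𝕜[x, y]`. -/
def yPart (T : Finset (α ⊕ₗ β)) : Finset β :=
  Finset.univ.filter fun b => toLex (Sum.inr b) ∈ T

@[simp] theorem inl_mem_glue (A : Finset α) (W : Finset β) (a : α) :
    toLex (Sum.inl a) ∈ glue A W ↔ a ∈ A := by
  simp [glue]

@[simp] theorem inr_mem_glue (A : Finset α) (W : Finset β) (b : β) :
    toLex (Sum.inr b) ∈ glue A W ↔ b ∈ W := by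
  simp [glue]

theorem ext_of_parts {T U : Finset (α ⊕ₗ β)}
    (hx : ∀ a, toLex (Sum.inl a) ∈ T ↔ toLex (Sum.inl a) ∈ U)
    (hy : ∀ b, toLex (Sum.inr b) ∈ T ↔ toLex (Sum.inr b) ∈ U) : T = U := by
  ext v
  obtain ⟨v, rfl⟩ := toLex.surjective v
  rcases v with a | b
  · exact hx a
  · exact hy b

@[simp] theorem xPart_glue (A : Finset α) (W : Finset β) : xPart (glue A W) = A := by
  ext a
  simp [xPart]

@[simp] theorem yPart_glue (A : Finset α) (W : Finset β) : yPart (glue A W) = W := by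
  ext b
  simp [yPart]

@[simp] theorem glue_parts (T : Finset (α ⊕ₗ β)) : glue (xPart T) (yPart T) = T :=
  ext_of_parts (by simp [xPart]) (by simp [yPart])

theorem eq_glue_empty {T : Finset (α ⊕ₗ β)} (h : ∀ b, toLex (Sum.inr b) ∉ T) :
    T = glue (xPart T) ∅ :=
  ext_of_parts (by simp [xPart]) (by simpa using h)

theorem card_glue (A : Finset α) (W : Finset β) : (glue A W).card = A.card + W.card := by
  rw [glue, Finset.card_union_of_disjoint, Finset.card_map, Finset.card_map]
  simp [Finset.disjoint_left]

theorem insert_inl_glue [DecidableEq (α ⊕ₗ β)] (A : Finset α) (W : Finset β) (a : α) :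
    insert (toLex (Sum.inl a)) (glue A W) = glue (insert a A) W :=
  ext_of_parts (by simp) (by simp)

theorem compl_glue [DecidableEq (α ⊕ₗ β)] (A : Finset α) (W : Finset β) : (glue A W)ᶜ = glue Aᶜ Wᶜ :=
  ext_of_parts (by simp) (by simp)

theorem sum_glue {M : Type*} [AddCommMonoid M] (A : Finset α) (W : Finset β)
    (f : α ⊕ₗ β → M) : ∑ v ∈ glue A W, f v =
      ∑ a ∈ A, f (toLex (Sum.inl a)) + ∑ b ∈ W, f (toLex (Sum.inr b)) := by
  rw [glue, Finset.sum_union, Finset.sum_map, Finset.sum_map]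
  · rfl
  · simp [Finset.disjoint_left]

/-- In the lexicographic sum every x precedes every y, so W does not enter the count. -/
theorem koszulSign_inl_glue (𝕜 : Type*) [Field 𝕜] (A : Finset α) (W : Finset β) (a : α) :
    koszulSign 𝕜 (toLex (Sum.inl a)) (glue A W) = koszulSign 𝕜 a A := by
  rw [koszulSign, koszulSign, glue, Finset.filter_union, Finset.filter_map, Finset.filter_map]
  congr 1
  rw [Finset.filter_false_of_mem (s := W), Finset.map_empty, Finset.union_empty, Finset.card_map]
  · congr 1
    refine Finset.filter_congr fun u _ => ?_
    simp
  · intro b _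
    simp

end Faces

/-! ### Slices of Koszul chains and the acyclicity lemma -/

section Slices

variable {𝕜 : Type*} [Field 𝕜] {α β : Type*} [Fintype α] [LinearOrder α] [Fintype β]
  [LinearOrder β]

/-- The part of a Koszul chain over `𝕜[x, y]` whose coefficients do not involve `y`,
split according to the set `W` of variables `y` that occur in `e_T`. -/
noncomputable def slice (W : Finset β) :
    (Finset (α ⊕ₗ β) → MvPolynomial (α ⊕ₗ β) 𝕜) →ₗ[𝕜] (Finset α → MvPolynomial α 𝕜) where
  toFun c A := retr 𝕜 α β (c (glue A W))
  map_add' a b := by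
    funext A
    simp
  map_smul' r a := by
    funext A
    simp

theorem slice_apply (W : Finset β) (c : Finset (α ⊕ₗ β) → MvPolynomial (α ⊕ₗ β) 𝕜)
    (A : Finset α) : slice W c A = retr 𝕜 α β (c (glue A W)) := rfl

/-- Contraction along a y_b brings in the factor y_b, which `retr` kills; only contractions along
the x survive, and they leave W fixed. -/
theorem slice_koszulDiff (W : Finset β) (c : Finset (α ⊕ₗ β) → MvPolynomial (α ⊕ₗ β) 𝕜) :
    slice W (koszulDiff 𝕜 (α ⊕ₗ β) c) = koszulDiff 𝕜 α (slice W c) := by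
  funext A
  rw [slice_apply, koszulDiff_apply, koszulDiff_apply, compl_glue, sum_glue, map_add, map_sum,
    map_sum, add_eq_left.mpr]
  · refine Finset.sum_congr rfl fun a _ => ?_
    rw [map_smul, map_mul, retr_X_inl, koszulSign_inl_glue, insert_inl_glue, slice_apply]
  · refine Finset.sum_eq_zero fun b _ => ?_
    rw [map_smul, map_mul, retr_X_inr, zero_mul, smul_zero]

/-- The chain `∑_W b_W e_W` over `𝕜[x, y]`. -/
noncomputable def embed : (Finset β → Finset α → MvPolynomial α 𝕜) →ₗ[𝕜]
    (Finset (α ⊕ₗ β) → MvPolynomial (α ⊕ₗ β) 𝕜) where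
  toFun b T := incl 𝕜 α β (b (yPart T) (xPart T))
  map_add' a b := by
    funext T
    simp
  map_smul' r a := by
    funext T
    simp

theorem embed_apply (b : Finset β → Finset α → MvPolynomial α 𝕜) (T : Finset (α ⊕ₗ β)) :
    embed b T = incl 𝕜 α β (b (yPart T) (xPart T)) := rfl

theorem slice_embed (W : Finset β) (b : Finset β → Finset α → MvPolynomial α 𝕜) :
    slice W (embed b) = b W := by
  funext A
  rw [slice_apply, embed_apply, retr_incl, xPart_glue, yPart_glue]

variable (I : Ideal (MvPolynomial α 𝕜))

theorem mem_koszulPiece_yIdeal_mul_iff (i j : ℕ)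
    (c : Finset (α ⊕ₗ β) → MvPolynomial (α ⊕ₗ β) 𝕜) :
    c ∈ koszulPiece (yIdeal 𝕜 α β * I.map (incl 𝕜 α β)) i j ↔
      c ∈ koszulPiece (I.map (incl 𝕜 α β)) i j ∧ ∀ W, slice W c = 0 := by
  constructor
  · intro h
    refine ⟨fun T => ⟨((mem_yIdeal_mul_iff I _).mp (h T).1).1, (h T).2⟩, fun W => ?_⟩
    funext A
    exact ((mem_yIdeal_mul_iff I _).mp (h _).1).2
  · rintro ⟨h1, h2⟩ T
    refine ⟨(mem_yIdeal_mul_iff I _).mpr ⟨(h1 T).1, ?_⟩, (h1 T).2⟩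
    rw [← glue_parts T]
    exact congrFun (h2 (yPart T)) (xPart T)

theorem degree_mapDomain_inl (m : α →₀ ℕ) :
    (m.mapDomain fun a => (toLex (Sum.inl a) : α ⊕ₗ β)).degree = m.degree := by
  rw [Finsupp.degree_mapDomain]

theorem slice_coeff_ne_zero {i j : ℕ} {c : Finset (α ⊕ₗ β) → MvPolynomial (α ⊕ₗ β) 𝕜}
    (hc : c ∈ koszulPiece (I.map (incl 𝕜 α β)) i j) {W : Finset β} {A : Finset α} {m : α →₀ ℕ}
    (hm : coeff m (slice W c A) ≠ 0) :
    A.card + W.card = i ∧ m.degree + (A.card + W.card) = j := by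
  rw [slice_apply, coeff_retr] at hm
  have := (hc _).2 _ hm
  rwa [card_glue, degree_mapDomain_inl] at this

theorem slice_mem_koszulPiece {i j : ℕ} {c : Finset (α ⊕ₗ β) → MvPolynomial (α ⊕ₗ β) 𝕜}
    (hc : c ∈ koszulPiece (I.map (incl 𝕜 α β)) i j) (W : Finset β) :
    slice W c ∈ koszulPiece I (i - W.card) (j - W.card) := by
  refine fun A => ⟨retr_mem I (hc _).1, fun m hm => ?_⟩
  have := slice_coeff_ne_zero I hc hm
  omega

/-- This makes the truncated subtractions in `slice_mem_koszulPiece` harmless: where they would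
truncate, the slice is zero. -/
theorem slice_eq_zero {i j : ℕ} {c : Finset (α ⊕ₗ β) → MvPolynomial (α ⊕ₗ β) 𝕜}
    (hc : c ∈ koszulPiece (I.map (incl 𝕜 α β)) i j) {W : Finset β}
    (hW : ¬ (W.card ≤ i ∧ W.card ≤ j)) : slice W c = 0 := by
  funext A
  ext m
  by_contra hm
  have := slice_coeff_ne_zero I hc hm
  omega

theorem embed_mem_koszulPiece {i j : ℕ} {b : Finset β → Finset α → MvPolynomial α 𝕜}
    (hb : ∀ W, b W ≠ 0 → W.card ≤ i ∧ W.card ≤ j ∧ b W ∈ koszulPiece I (i - W.card) (j - W.card)) :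
    embed b ∈ koszulPiece (I.map (incl 𝕜 α β)) i j := by
  intro T
  by_cases h0 : b (yPart T) = 0
  · simp [embed_apply, h0]
  obtain ⟨h1, h2, h3⟩ := hb _ h0
  refine ⟨incl_mem I (h3 _).1, fun m hm => ?_⟩
  obtain ⟨u, rfl, hu⟩ := coeff_rename_ne_zero _ _ _ hm
  have h4 := (h3 _).2 u hu
  have h5 := card_glue (xPart T) (yPart T)
  rw [glue_parts] at h5
  rw [degree_mapDomain_inl]
  omega

/-- A cycle whose monomials all involve `y` is the boundary of a chain of the same kind, because
membership of a monomial in the ideal does not depend on its `y`-part. -/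
theorem exists_koszulDiff_eq_of_slice_empty {I : Ideal (MvPolynomial α 𝕜)} {A : Set (α →₀ ℕ)}
    (hI : I = Ideal.span ((fun a => monomial a (1 : 𝕜)) '' A)) {i j : ℕ}
    {c : Finset (α ⊕ₗ β) → MvPolynomial (α ⊕ₗ β) 𝕜}
    (hc : c ∈ koszulPiece (I.map (incl 𝕜 α β)) i j) (hker : koszulDiff 𝕜 (α ⊕ₗ β) c = 0)
    (hs : slice ∅ c = 0) :
    ∃ g ∈ koszulPiece (I.map (incl 𝕜 α β)) (i + 1) j,
      koszulDiff 𝕜 (α ⊕ₗ β) g = c ∧ slice ∅ g = 0 := by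
  have hs' : ∀ (B : Finset α) (m : α →₀ ℕ),
      coeff (m.mapDomain fun a => toLex (Sum.inl a)) (c (glue B ∅)) = 0 := fun B m => by
    rw [← coeff_retr]
    exact (congrArg (coeff m) (congrFun hs B)).trans (coeff_zero m)
  have h0 : coeff 0 (c ∅) = 0 := by simpa [glue] using hs' ∅ 0
  -- The y come last, so the greatest variable of a monomial m e_T that involves some y is itself a
  -- y.
  obtain ⟨g, hg, hsupp⟩ := exists_koszulDiff_eq_of_max c hker h0
  have key : ∀ U m, coeff m (g U) ≠ 0 → ∃ b : β, toLex (Sum.inr b) ∈ U ∧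
      coeff (m + Finsupp.single (toLex (Sum.inr b)) 1) (c (U.erase (toLex (Sum.inr b)))) ≠ 0 := by
    intro U m hm
    obtain ⟨w, hw, hmax, hm0, hne⟩ := hsupp U m hm
    obtain ⟨w, rfl⟩ := toLex.surjective w
    rcases w with a | b
    -- If the greatest variable were an x, no y would occur, and `c` would have a y-free monomial in
    -- its ∅-slice.
    · exfalso
      have hmx : m + Finsupp.single (toLex (Sum.inl a)) 1 =
          Finsupp.mapDomain (fun a => toLex (Sum.inl a))
            ((m + Finsupp.single (toLex (Sum.inl a)) 1).comapDomain
              (fun a => toLex (Sum.inl a)) inl_injective.injOn) := by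
        refine (Finsupp.mapDomain_comapDomain _ inl_injective _ fun v hv => ?_).symm
        obtain ⟨v, rfl⟩ := toLex.surjective v
        rcases v with a' | b
        · exact ⟨a', rfl⟩
        · rw [Finset.mem_coe, Finsupp.mem_support_iff, Finsupp.add_apply,
            hm0 _ (Sum.Lex.inl_lt_inr a b), Finsupp.single_eq_of_ne (inl_ne_inr a b).symm] at hv
          exact absurd rfl hv
      rw [hmx] at hne
      refine hne ((congrArg (fun T => coeff _ (c T)) (eq_glue_empty fun b hb => ?_)).trans (hs' _ _))
      exact not_le.mpr (Sum.Lex.inl_lt_inr a b) (hmax _ (Finset.mem_of_mem_erase hb))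
    · exact ⟨b, hw, hne⟩
  refine ⟨g, fun U => ⟨?_, fun m hm => ?_⟩, hg, ?_⟩
  · rw [hI, mem_map_incl_span_monomial_iff]
    intro m hm
    obtain ⟨b, hb, hne⟩ := key U m hm
    have h1 := (hc (U.erase (toLex (Sum.inr b)))).1
    rw [hI, mem_map_incl_span_monomial_iff] at h1
    exact add_single_inr_mem b m (h1 _ hne)
  · obtain ⟨b, hb, hne⟩ := key U m hm
    have h1 := (hc _).2 _ hne
    have h2 := Finset.card_erase_add_one hb
    simp only [map_add, Finsupp.degree_single] at h1
    omega
  · funext B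
    ext m
    rw [slice_apply, coeff_retr]
    by_contra hm
    obtain ⟨b, hb, -⟩ := key _ _ hm
    simp at hb

end Slices

/-! ### Finite dimension of the graded pieces -/

section Finiteness

variable {𝕜 : Type*} [Field 𝕜] {σ : Type*} [Fintype σ] [LinearOrder σ]

instance finite_koszulPiece (I : Ideal (MvPolynomial σ 𝕜)) (i j : ℕ) :
    Module.Finite 𝕜 (koszulPiece I i j) := by
  have h : ∀ (T : Finset σ) (c : koszulPiece I i j),
      c.1 T ∈ restrictTotalDegree σ 𝕜 j := fun T c => by
    rw [mem_restrictTotalDegree, totalDegree]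
    refine Finset.sup_le fun m hm => ?_
    have := (c.2 T).2 m (mem_support_iff.mp hm)
    have h2 : m.degree = m.sum fun _ e => e := rfl
    omega
  let f : koszulPiece I i j →ₗ[𝕜] (Finset σ → restrictTotalDegree σ 𝕜 j) :=
    LinearMap.pi fun T => ((LinearMap.proj T).comp (koszulPiece I i j).subtype).codRestrict _ (h T)
  refine Module.Finite.of_injective f fun a b hab => ?_
  ext1
  funext T
  exact congrArg Subtype.val (congrFun hab T)

instance finite_torCycles (I : Ideal (MvPolynomial σ 𝕜)) (i j : ℕ) :
    Module.Finite 𝕜 (torCycles I i j) :=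
  Submodule.finiteDimensional_of_le inf_le_left

theorem koszulDiff_mem_koszulPiece {I : Ideal (MvPolynomial σ 𝕜)} {i j : ℕ}
    {c : Finset σ → MvPolynomial σ 𝕜} (hc : c ∈ koszulPiece I (i + 1) j) :
    koszulDiff 𝕜 σ c ∈ koszulPiece I i j :=
  (torBoundaries_le_torCycles I i j ⟨c, hc, rfl⟩).1

end Finiteness

/-! ### The connecting isomorphism and the Betti numbers -/

section Kunneth

variable {𝕜 : Type*} [Field 𝕜] {α β : Type*} [Fintype α] [LinearOrder α] [Fintype β]
  [LinearOrder β] (I : Ideal (MvPolynomial α 𝕜)) (i j : ℕ)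

/-- The nonempty sets of variables `y` that contribute to degree `j` of the `i`-th Tor. -/
abbrev FaceIndex (β : Type*) (i j : ℕ) : Type _ :=
  {W : Finset β // W.Nonempty ∧ W.card ≤ i + 1 ∧ W.card ≤ j}

open Classical in
/-- Extension by zero of a family of cycles. -/
noncomputable def extendCycles :
    (∀ W : FaceIndex β i j, torCycles I (i + 1 - W.1.card) (j - W.1.card)) →ₗ[𝕜]
      (Finset β → Finset α → MvPolynomial α 𝕜) :=
  LinearMap.pi fun W => if h : W.Nonempty ∧ W.card ≤ i + 1 ∧ W.card ≤ j then
    (Submodule.subtype _).comp (LinearMap.proj (⟨W, h⟩ : FaceIndex β i j)) else 0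

variable {I i j}

theorem extendCycles_coe (z : ∀ W : FaceIndex β i j, torCycles I (i + 1 - W.1.card) (j - W.1.card))
    (W : FaceIndex β i j) : extendCycles I i j z W.1 = z W := by
  rw [extendCycles, LinearMap.pi_apply, dif_pos W.2]
  rfl

theorem extendCycles_of_not
    (z : ∀ W : FaceIndex β i j, torCycles I (i + 1 - W.1.card) (j - W.1.card))
    {W : Finset β} (h : ¬ (W.Nonempty ∧ W.card ≤ i + 1 ∧ W.card ≤ j)) :
    extendCycles I i j z W = 0 := by
  rw [extendCycles, LinearMap.pi_apply, dif_neg h]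
  rfl

theorem koszulDiff_extendCycles
    (z : ∀ W : FaceIndex β i j, torCycles I (i + 1 - W.1.card) (j - W.1.card)) (W : Finset β) :
    koszulDiff 𝕜 α (extendCycles I i j z W) = 0 := by
  by_cases h : W.Nonempty ∧ W.card ≤ i + 1 ∧ W.card ≤ j
  · rw [extendCycles_coe z ⟨W, h⟩]
    exact (z ⟨W, h⟩).2.2
  · rw [extendCycles_of_not z h, map_zero]

theorem embed_extendCycles_mem
    (z : ∀ W : FaceIndex β i j, torCycles I (i + 1 - W.1.card) (j - W.1.card)) :
    embed (extendCycles I i j z) ∈ koszulPiece (I.map (incl 𝕜 α β)) (i + 1) j := by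
  refine embed_mem_koszulPiece I fun W hW => ?_
  have h : W.Nonempty ∧ W.card ≤ i + 1 ∧ W.card ≤ j := by
    by_contra h
    exact hW (extendCycles_of_not z h)
  refine ⟨h.2.1, h.2.2, ?_⟩
  rw [extendCycles_coe z ⟨W, h⟩]
  exact (z ⟨W, h⟩).2.1

theorem koszulDiff_embed_extendCycles_mem
    (z : ∀ W : FaceIndex β i j, torCycles I (i + 1 - W.1.card) (j - W.1.card)) :
    koszulDiff 𝕜 (α ⊕ₗ β) (embed (extendCycles I i j z)) ∈
      torCycles (yIdeal 𝕜 α β * I.map (incl 𝕜 α β)) i j := by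
  refine ⟨(mem_koszulPiece_yIdeal_mul_iff I i j _).mpr
    ⟨koszulDiff_mem_koszulPiece (embed_extendCycles_mem z), fun W => ?_⟩, koszulDiff_koszulDiff _⟩
  rw [slice_koszulDiff, slice_embed, koszulDiff_extendCycles]

variable (I i j) in
/-- The connecting map `(z_W) ↦ ∂ (∑_W z_W e_W)`. -/
noncomputable def connecting :
    (∀ W : FaceIndex β i j, torCycles I (i + 1 - W.1.card) (j - W.1.card)) →ₗ[𝕜]
      GradedTor (yIdeal 𝕜 α β * I.map (incl 𝕜 α β)) i j :=
  (Submodule.mkQ _).comp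
    (((koszulDiff 𝕜 (α ⊕ₗ β)).comp (embed.comp (extendCycles I i j))).codRestrict _
      koszulDiff_embed_extendCycles_mem)

variable {A : Set (α →₀ ℕ)}

theorem connecting_surjective
    (hI : I = Ideal.span ((fun a => monomial a (1 : 𝕜)) '' A)) :
    Function.Surjective (connecting (β := β) I i j) := by
  intro q
  obtain ⟨⟨c, hc⟩, rfl⟩ := Submodule.mkQ_surjective _ q
  obtain ⟨hcp, hck⟩ := hc
  obtain ⟨hcI, hcs⟩ := (mem_koszulPiece_yIdeal_mul_iff I i j c).mp hcp
  obtain ⟨g, hg, hgc, hgs⟩ := exists_koszulDiff_eq_of_slice_empty hI hcI hck (hcs ∅)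
  -- The slices of `g` are cycles because ∂g = `c` lies over the product ideal and so has zero
  -- slices.
  let z : ∀ W : FaceIndex β i j, torCycles I (i + 1 - W.1.card) (j - W.1.card) := fun W =>
    ⟨slice W.1 g, slice_mem_koszulPiece I hg W.1, by
      rw [SetLike.mem_coe, LinearMap.mem_ker, ← slice_koszulDiff, hgc, hcs]⟩
  have hz : ∀ W, extendCycles I i j z W = slice W g := fun W => by
    by_cases h : W.Nonempty ∧ W.card ≤ i + 1 ∧ W.card ≤ j
    · exact extendCycles_coe z ⟨W, h⟩
    · rw [extendCycles_of_not z h]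
      rcases W.eq_empty_or_nonempty with rfl | hW
      · exact hgs.symm
      · exact (slice_eq_zero I hg fun h' => h ⟨hW, h'⟩).symm
  refine ⟨z, ?_⟩
  rw [connecting, LinearMap.comp_apply, ← sub_eq_zero, ← map_sub, Submodule.mkQ_apply,
    Submodule.Quotient.mk_eq_zero, Submodule.submoduleOf, Submodule.mem_comap]
  -- All slices of this difference vanish, so it is a chain over the product ideal; its boundary is
  -- the difference of the two representatives.
  refine ⟨embed (extendCycles I i j z) - g, (mem_koszulPiece_yIdeal_mul_iff I _ j _).mpr
    ⟨sub_mem (embed_extendCycles_mem z) hg, fun W => ?_⟩, ?_⟩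
  · rw [map_sub, slice_embed, hz, sub_self]
  · rw [map_sub, hgc]
    rfl

theorem ker_connecting (hI : I = Ideal.span ((fun a => monomial a (1 : 𝕜)) '' A)) :
    LinearMap.ker (connecting (β := β) I i j) =
    Submodule.pi Set.univ fun W : FaceIndex β i j =>
      (torBoundaries I (i + 1 - W.1.card) (j - W.1.card)).submoduleOf
        (torCycles I (i + 1 - W.1.card) (j - W.1.card)) := by
  ext z
  rw [LinearMap.mem_ker, connecting, LinearMap.comp_apply, Submodule.mkQ_apply,
    Submodule.Quotient.mk_eq_zero, Submodule.submoduleOf, Submodule.mem_comap, Submodule.mem_pi]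
  have hzm := embed_extendCycles_mem z
  constructor
  · rintro ⟨a, ha, haz⟩ W -
    obtain ⟨haI, has⟩ := (mem_koszulPiece_yIdeal_mul_iff I _ j a).mp ha
    have haz' : koszulDiff 𝕜 (α ⊕ₗ β) a =
      koszulDiff 𝕜 (α ⊕ₗ β) (embed (extendCycles I i j z)) := haz
    -- ∑ z_W e_W - `a` is a cycle with zero ∅-slice, hence some ∂g; since `a` has zero slices,
    -- slicing at W gives z_W = ∂(slice of `g`).
    obtain ⟨g, hg, hgd, -⟩ := exists_koszulDiff_eq_of_slice_empty hI (sub_mem hzm haI)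
      (by rw [map_sub, haz', sub_self])
      (by rw [map_sub, slice_embed, has, sub_zero]
          exact extendCycles_of_not z (by simp))
    rw [Submodule.submoduleOf, Submodule.mem_comap]
    refine ⟨slice W.1 g, ?_, ?_⟩
    · have h := slice_mem_koszulPiece I hg W.1
      rwa [show i + 1 + 1 - W.1.card = i + 1 - W.1.card + 1 by have := W.2.2.1; omega] at h
    · rw [← slice_koszulDiff, hgd, map_sub, slice_embed, has, sub_zero, extendCycles_coe]
      rfl
  · intro h
    have h' : ∀ W : Finset β, ∃ a : Finset α → MvPolynomial α 𝕜,
        koszulDiff 𝕜 α a = extendCycles I i j z W ∧ (a ≠ 0 → W.card ≤ i + 1 ∧ W.card ≤ j ∧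
          a ∈ koszulPiece I (i + 1 - W.card + 1) (j - W.card)) := fun W => by
      by_cases hW : W.Nonempty ∧ W.card ≤ i + 1 ∧ W.card ≤ j
      · obtain ⟨a, ha, haz⟩ := h ⟨W, hW⟩ (Set.mem_univ _)
        refine ⟨a, ?_, fun _ => ⟨hW.2.1, hW.2.2, ha⟩⟩
        rw [extendCycles_coe z ⟨W, hW⟩]
        exact haz
      · exact ⟨0, by rw [map_zero, extendCycles_of_not z hW], fun h => absurd rfl h⟩
    choose a ha ham using h'
    have hem : embed a ∈ koszulPiece (I.map (incl 𝕜 α β)) (i + 1 + 1) j :=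
      embed_mem_koszulPiece I fun W hW => by
        obtain ⟨h1, h2, h3⟩ := ham W hW
        refine ⟨by omega, h2, ?_⟩
        rwa [show i + 1 + 1 - W.card = i + 1 - W.card + 1 by omega]
    -- Subtracting ∂(∑ a_W e_W), where ∂a_W = z_W, leaves the boundary unchanged and kills every
    -- slice.
    refine ⟨embed (extendCycles I i j z) - koszulDiff 𝕜 (α ⊕ₗ β) (embed a),
      (mem_koszulPiece_yIdeal_mul_iff I _ j _).mpr
        ⟨sub_mem hzm (koszulDiff_mem_koszulPiece hem), fun W => ?_⟩, ?_⟩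
    · rw [map_sub, slice_koszulDiff, slice_embed, slice_embed, ha, sub_self]
    · rw [map_sub, koszulDiff_koszulDiff, sub_zero]
      rfl

theorem gradedBetti_yIdeal_mul
    (hI : I = Ideal.span ((fun a => monomial a (1 : 𝕜)) '' A)) :
    gradedBetti (yIdeal 𝕜 α β * I.map (incl 𝕜 α β)) i j =
      ∑ W : FaceIndex β i j, gradedBetti I (i + 1 - W.1.card) (j - W.1.card) := by
  classical
  have e : GradedTor (yIdeal 𝕜 α β * I.map (incl 𝕜 α β)) i j ≃ₗ[𝕜]
      ∀ W : FaceIndex β i j, GradedTor I (i + 1 - W.1.card) (j - W.1.card) :=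
    ((connecting I i j).quotKerEquivOfSurjective (connecting_surjective hI)).symm.trans
      ((Submodule.quotEquivOfEq _ _ (ker_connecting hI)).trans (Submodule.quotientPi _))
  have : ∀ W : FaceIndex β i j,
      Module.Free 𝕜 (GradedTor I (i + 1 - W.1.card) (j - W.1.card)) := fun W =>
    Module.Free.of_divisionRing _ _
  rw [gradedBetti, e.finrank_eq, Module.finrank_pi_fintype]
  rfl

theorem totalBetti_eq {σ : Type*} [Fintype σ] [LinearOrder σ] {I : Ideal (MvPolynomial σ 𝕜)}
    {d : ℕ} (h : ∀ i a : ℕ, a ≠ i + d → gradedBetti I i a = 0) (i : ℕ) :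
    totalBetti I i = gradedBetti I i (i + d) :=
  finsum_eq_single _ _ fun a ha => h i a ha

theorem isGeneratedInDegree_yIdeal_mul {d : ℕ} (h : IsGeneratedInDegree I d) :
    IsGeneratedInDegree (yIdeal 𝕜 α β * I.map (incl 𝕜 α β)) (d + 1) := by
  refine le_antisymm ?_ (Ideal.span_le.mpr fun f hf => hf.1)
  conv_lhs => rw [yIdeal, h, Ideal.map_span, Ideal.span_mul_span']
  rw [Ideal.span_le]
  rintro _ ⟨_, ⟨b, rfl⟩, _, ⟨f, ⟨hf, hd⟩, rfl⟩, rfl⟩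
  refine Ideal.subset_span ⟨Ideal.mul_mem_mul (Ideal.subset_span ⟨b, rfl⟩) (incl_mem I hf), ?_⟩
  rw [add_comm]
  exact (isHomogeneous_X 𝕜 _).mul hd.rename_isHomogeneous

theorem gradedBetti_yIdeal_mul_eq_zero
    (hI : I = Ideal.span ((fun a => monomial a (1 : 𝕜)) '' A)) {d : ℕ}
    (h : ∀ i a : ℕ, a ≠ i + d → gradedBetti I i a = 0) (hj : j ≠ i + (d + 1)) :
    gradedBetti (yIdeal 𝕜 α β * I.map (incl 𝕜 α β)) i j = 0 := by
  rw [gradedBetti_yIdeal_mul hI]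
  refine Finset.sum_eq_zero fun W _ => h _ _ ?_
  -- The bounds on |W| exclude truncation, so |W| cancels from both indices.
  have := W.2.2
  omega

theorem totalBetti_yIdeal_mul
    (hI : I = Ideal.span ((fun a => monomial a (1 : 𝕜)) '' A)) {d : ℕ}
    (h : ∀ i a : ℕ, a ≠ i + d → gradedBetti I i a = 0) :
    totalBetti (yIdeal 𝕜 α β * I.map (incl 𝕜 α β)) i =
      ∑ s ∈ Finset.range (Fintype.card β), (Fintype.card β).choose (s + 1) *
        (if s ≤ i then totalBetti I (i - s) else 0) := by
  classical
  rw [totalBetti_eq (d := d + 1) (fun i a ha => gradedBetti_yIdeal_mul_eq_zero hI h ha),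
    gradedBetti_yIdeal_mul hI]
  -- The summand depends only on m = |W|. The value at m = 0 is zero since W = ∅ is excluded, and m
  -- = s + 1 gives β_{i-s}.
  let f : ℕ → ℕ := fun m => if 0 < m ∧ m ≤ i + 1 then totalBetti I (i + 1 - m) else 0
  have h1 : ∑ W : FaceIndex β i (i + (d + 1)),
      gradedBetti I (i + 1 - W.1.card) (i + (d + 1) - W.1.card) = ∑ W : Finset β, f W.card := by
    simp only [f]
    rw [← Finset.sum_filter, Finset.sum_subtype _ (p := fun W : Finset β =>
      W.Nonempty ∧ W.card ≤ i + 1 ∧ W.card ≤ i + (d + 1))]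
    · refine Finset.sum_congr rfl fun W _ => ?_
      have := W.2.2.1
      rw [totalBetti_eq h, show i + 1 - W.1.card + d = i + (d + 1) - W.1.card by omega]
    · intro W
      rw [Finset.mem_filter, Finset.card_pos]
      simp only [Finset.mem_univ, true_and, and_congr_right_iff]
      omega
  have h2 := Finset.sum_powerset_apply_card f (x := (Finset.univ : Finset β))
  rw [Finset.powerset_univ, Finset.card_univ, Finset.sum_range_succ'] at h2
  rw [h1, h2]
  simp only [f, smul_eq_mul, lt_irrefl, false_and, if_false, mul_zero, add_zero, Nat.succ_pos,
    true_and, Nat.add_le_add_iff_right, Nat.add_sub_add_right]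

end Kunneth

end LinRes

theorem proposition3p3 {𝕜 : Type*} [Field 𝕜] (n k d : ℕ) (hk : 0 < k)
    (I : Ideal (MvPolynomial (Fin n) 𝕜)) (hI : LinRes.IsSquarefreeMonomialIdeal I)
    (hlin : LinRes.HasLinearResolution I d)
    -- `IR` and `N` are the extensions of `I` and of `(y_1, …, y_k)` to `𝕜[x_1, …, x_n, y_1, …, y_k]`
    (IR N : Ideal (MvPolynomial (Fin n ⊕ₗ Fin k) 𝕜))
    (hIR : IR = I.map (MvPolynomial.rename (fun a : Fin n => toLex (Sum.inl a)) :
      MvPolynomial (Fin n) 𝕜 →ₐ[𝕜] MvPolynomial (Fin n ⊕ₗ Fin k) 𝕜))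
    (hN : N = Ideal.span (Set.range fun b : Fin k => MvPolynomial.X (toLex (Sum.inr b)))) :
    LinRes.HasLinearResolution (N * IR) (d + 1) ∧
    ∀ i : ℕ, LinRes.totalBetti (N * IR) i =
      ∑ s ∈ Finset.range k, k.choose (s + 1) * (if s ≤ i then LinRes.totalBetti I (i - s) else 0) := by
  obtain ⟨A, -, hA⟩ := hI
  subst hIR hN
  refine ⟨⟨LinRes.isGeneratedInDegree_yIdeal_mul hlin.1, fun i a ha =>
    LinRes.gradedBetti_yIdeal_mul_eq_zero hA hlin.2 ha⟩, fun i => ?_⟩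
  have h := LinRes.totalBetti_yIdeal_mul (β := Fin k) (i := i) hA hlin.2
  rw [Fintype.card_fin] at h
  exact h
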